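/- Let $H$ be a complex Hilbert space with scalar product $(\cdot,\cdot)$, linear in the first and conjugate-linear in the second argument. Let $\{\mathcal U(t)\}_{t\ge 0}$ be a strongly continuous semigroup of bounded linear operators on $H$ with generator $\mathcal L x=\lim_{h\searrow 0}\frac1h[\mathcal U(h)x-x]$, whose domain $D(\mathcal L)$ is the set of all $x\in H$ for which this limit exists in $H$, and let $\mathcal L^\dagger$ be the adjoint of $\mathcal L$. Let $z\in D(\mathcal L)\cap D(\mathcal L^\dagger)$ with $z\neq 0$, and put $\mathcal P x:=(x,z)(z,z)^{-1}z$ and $\mathcal Q:=1-\mathcal P$. Then the operator $\mathcal{QL}$ (with domain $D(\mathcal L)$) is closable, and there is exactly one strongly continuous semigroup $\{\mathcal G(t)\}_{t\ge 0}$ of bounded linear operators on $H$ whose generator is $\overline{\mathcal{QL}}\,\mathcal Q$, with domain $\{x\in H:\mathcal Qx\in D(\overline{\mathcal{QL}})\}$. Moreover, with $$K(t):=(\mathcal G(t)\mathcal{QL}z,\ \mathcal Q\mathcal L^\dagger z)\,(z,z)^{-1},\qquad t\ge 0,$$ for every $t\ge 0$ one has $\mathcal U(t)z\in D(\mathcal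 L)$, the function $s\mapsto K(t-s)\,\mathcal U(s)z$ is integrable on $[0,t]$, and the orbit map $t\mapsto \mathcal U(t)z$ is differentiable on $[0,\infty)$ (from the right at $t=0$) with $$\frac{d}{dt}\,\mathcal U(t)z=\mathcal U(t)\mathcal{PL}z+\mathcal G(t)\mathcal{QL}z+\int_0^t K(t-s)\,\mathcal U(s)z\,ds .$$ -/

import Mathlib

open Set Filter Topology
open scoped LinearPMap

namespace MoriGLE

variable {H : Type*} [NormedAddCommGroup H] [InnerProductSpace ℂ H]

/-- `U` is a strongly continuous one-parameter semigroup of bounded operators on `H`.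
Only the values `U t` with `0 ≤ t` are relevant. -/
structure IsC0Semigroup (U : ℝ → H →L[ℂ] H) : Prop where
  map_zero : U 0 = 1
  map_add : ∀ s t : ℝ, 0 ≤ s → 0 ≤ t → U (s + t) = U s * U t
  continuousOn_orbit : ∀ x : H, ContinuousOn (fun t : ℝ => U t x) (Ici 0)

/-- `y` is the limit of the difference quotients `(U h x - x) / h` as `h ↘ 0`. -/
def HasGeneratorValue (U : ℝ → H →L[ℂ] H) (x y : H) : Prop :=
  Tendsto (fun h : ℝ => h⁻¹ • (U h x - x)) (𝓝[>] 0) (𝓝 y)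

theorem HasGeneratorValue.unique {U : ℝ → H →L[ℂ] H} {x y y' : H}
    (h : HasGeneratorValue U x y) (h' : HasGeneratorValue U x y') : y = y' :=
  tendsto_nhds_unique h h'

theorem HasGeneratorValue.add {U : ℝ → H →L[ℂ] H} {x x' y y' : H}
    (h : HasGeneratorValue U x y) (h' : HasGeneratorValue U x' y') :
    HasGeneratorValue U (x + x') (y + y') := by
  refine (Tendsto.add h h').congr fun t => ?_
  rw [_root_.map_add, ← smul_add]
  congr 1
  abel

theorem HasGeneratorValue.smul {U : ℝ → H →L[ℂ] H} {x y : H} (c : ℂ)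
    (h : HasGeneratorValue U x y) : HasGeneratorValue U (c • x) (c • y) := by
  refine (Tendsto.const_smul h c).congr fun t => ?_
  rw [map_smul, ← smul_sub, smul_comm]

theorem HasGeneratorValue.zero (U : ℝ → H →L[ℂ] H) : HasGeneratorValue U 0 0 := by
  simp [HasGeneratorValue]

/-- The generator of `U`: the operator `x ↦ lim_{h ↘ 0} (U h x - x) / h`, on the domain of all
`x` for which this limit exists in `H`. -/
noncomputable def generator (U : ℝ → H →L[ℂ] H) : H →ₗ.[ℂ] H where
  domain :=
    { carrier := {x | ∃ y, HasGeneratorValue U x y}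
      add_mem' := fun ⟨y, hy⟩ ⟨y', hy'⟩ => ⟨y + y', hy.add hy'⟩
      zero_mem' := ⟨0, HasGeneratorValue.zero U⟩
      smul_mem' := fun c _ ⟨y, hy⟩ => ⟨c • y, hy.smul c⟩ }
  toFun :=
    { toFun := fun x => x.2.choose
      map_add' := fun x x' =>
        (x + x').2.choose_spec.unique (x.2.choose_spec.add x'.2.choose_spec)
      map_smul' := fun c x =>
        (c • x).2.choose_spec.unique (x.2.choose_spec.smul c) }

theorem mem_generator_domain {U : ℝ → H →L[ℂ] H} {x : H} :
    x ∈ (generator U).domain ↔ ∃ y, HasGeneratorValue U x y :=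
  Iff.rfl

theorem generator_spec (U : ℝ → H →L[ℂ] H) (x : (generator U).domain) :
    HasGeneratorValue U x (generator U x) :=
  x.2.choose_spec

/-- The Mori projection `P x = (x, z) (z, z)⁻¹ z`, where `(x, y) = inner ℂ y x` is linear in its
first argument. -/
noncomputable def moriP (z : H) : H →L[ℂ] H :=
  (inner ℂ z z)⁻¹ • (innerSL ℂ z).smulRight z

theorem moriP_apply (z x : H) : moriP z x = (inner ℂ z x / inner ℂ z z) • z := by
  simp [moriP, smul_smul, div_eq_inv_mul]

/-- The complementary projection `Q = 1 - P`. -/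
noncomputable def moriQ (z : H) : H →L[ℂ] H := 1 - moriP z

/-- The product `T B` of an unbounded operator `T` and a bounded operator `B`, with its natural
domain `{x | B x ∈ D(T)}`. -/
def compBounded (T : H →ₗ.[ℂ] H) (B : H →L[ℂ] H) : H →ₗ.[ℂ] H where
  domain := T.domain.comap (B : H →ₗ[ℂ] H)
  toFun :=
    { toFun := fun x => T ⟨B x, x.2⟩
      map_add' := fun x y => by
        rw [← LinearPMap.map_add]
        congr 1
        ext
        simp
      map_smul' := fun c x => by
        rw [RingHom.id_apply, ← LinearPMap.map_smul]
        congr 1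
        ext
        simp }

/-- The operator `Q L`, with domain `D(L)`. -/
noncomputable def opQL (L : H →ₗ.[ℂ] H) (z : H) : H →ₗ.[ℂ] H :=
  ((moriQ z : H →L[ℂ] H) : H →ₗ[ℂ] H).compPMap L

/-- The operator `closure(Q L) Q`, with domain `{x | Q x ∈ D(closure(Q L))}`. -/
noncomputable def orthogonalGenerator (L : H →ₗ.[ℂ] H) (z : H) : H →ₗ.[ℂ] H :=
  compBounded (opQL L z).closure (moriQ z)

/-- The memory kernel `K(t) = (G(t) Q L z, Q L† z) (z, z)⁻¹`, where `(x, y) = inner ℂ y x`. -/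
noncomputable def memoryKernel [CompleteSpace H] (L : H →ₗ.[ℂ] H) (G : ℝ → H →L[ℂ] H) (z : H)
    (hz : z ∈ L.domain) (hz' : z ∈ L†.domain) (t : ℝ) : ℂ :=
  inner ℂ (moriQ z (L† ⟨z, hz'⟩)) (G t (moriQ z (L ⟨z, hz⟩))) / inner ℂ z z

end MoriGLE

namespace MoriGLE

open MeasureTheory
open scoped BoundedContinuousFunction

variable {H : Type*} [NormedAddCommGroup H] [InnerProductSpace ℂ H] {U : ℝ → H →L[ℂ] H}

/-! Since `(Lx, z) = (x, L†z)` on `D(L)`, `PL` extends to a bounded operator. So `QL` is `L` minus a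
bounded operator, hence already closed, and because `z ∈ D(L)` the projection `Q` preserves `D(L)`.
Thus `QLQ = L + A` on `D(L)` with `A` bounded (`moriPerturbation`), and bounded perturbation theory
gives `G` together with Duhamel's formula `G(t)x = U(t)x + ∫ U(t-s) A G(s)x ds`
(`exists_perturbation`). Uniqueness holds because a generator determines its semigroup
(`eq_of_generator_eq`).

For `v = QLz`, the orbit `G(s)v` stays orthogonal to `z` (`inner_apply_eq`), and there `-A G(s)v =
K(s)z`. Duhamel's formula therefore reads `U(t)v = G(t)v + ∫ K(s) U(t-s)z ds`; inserting it into
`d/dt U(t)z = U(t)Lz = U(t)PLz + U(t)v` gives the claim.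

Semigroups are constrained only at nonnegative times; clamping to `max t 0` makes the orbits
continuous on all of `ℝ`. -/

theorem IsC0Semigroup.map_add_apply (hU : IsC0Semigroup U) {s t : ℝ} (hs : 0 ≤ s) (ht : 0 ≤ t)
    (x : H) : U (s + t) x = U s (U t x) := by
  rw [hU.map_add s t hs ht]; rfl

theorem IsC0Semigroup.map_zero_apply (hU : IsC0Semigroup U) (x : H) : U 0 x = x := by
  rw [hU.map_zero]; rfl

/-! ### Exponential growth bound and joint continuity. -/

theorem IsC0Semigroup.continuous_orbit_max (hU : IsC0Semigroup U) (x : H) :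
    Continuous fun t : ℝ => U (max t 0) x :=
  (hU.continuousOn_orbit x).comp_continuous (by fun_prop) fun t => le_max_right t 0

/-- Uniform boundedness controls `U` on `[0, 1]`; writing `t` as its integer part plus a remainder
propagates the bound. -/
theorem IsC0Semigroup.exists_exp_bound [CompleteSpace H] (hU : IsC0Semigroup U) :
    ∃ M ω : ℝ, 0 < M ∧ 0 ≤ ω ∧ ∀ t, 0 ≤ t → ‖U t‖ ≤ M * Real.exp (ω * t) := by
  obtain ⟨C', hC'⟩ : ∃ C', ∀ i : Icc (0 : ℝ) 1, ‖U i‖ ≤ C' := by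
    refine banach_steinhaus fun x => ?_
    obtain ⟨C, hC⟩ := isCompact_Icc.exists_bound_of_continuousOn
      ((hU.continuousOn_orbit x).mono (Icc_subset_Ici_self : Icc (0 : ℝ) 1 ⊆ Ici 0))
    exact ⟨C, fun i => hC i i.2⟩
  set C := max C' 1 with hCdef
  have hC1 : 1 ≤ C := le_max_right _ _
  have hC : ∀ r, 0 ≤ r → r ≤ 1 → ‖U r‖ ≤ C := fun r h0 h1 =>
    (hC' ⟨r, h0, h1⟩).trans (le_max_left _ _)
  have key : ∀ (n : ℕ) (r : ℝ), 0 ≤ r → r ≤ 1 → ‖U (n + r)‖ ≤ C ^ (n + 1) := by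
    intro n r h0 h1
    induction n with
    | zero => simpa using hC r h0 h1
    | succ n ih =>
      have h : ((n + 1 : ℕ) : ℝ) + r = 1 + (n + r) := by push_cast; ring
      rw [h, hU.map_add 1 (n + r) zero_le_one (by positivity), pow_succ']
      exact (norm_mul_le _ _).trans
        (mul_le_mul (hC 1 zero_le_one le_rfl) ih (norm_nonneg _) (by positivity))
  refine ⟨C, Real.log C, by positivity, Real.log_nonneg hC1, fun t ht => ?_⟩
  have hfl := Nat.floor_le ht
  have h := key ⌊t⌋₊ (t - ⌊t⌋₊) (by linarith) (by linarith [Nat.lt_floor_add_one t])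
  rw [add_sub_cancel] at h
  refine h.trans ?_
  rw [pow_succ']
  gcongr
  rw [← Real.exp_log (lt_of_lt_of_le one_pos hC1), ← Real.exp_nat_mul, Real.log_exp]
  refine Real.exp_le_exp.2 ?_
  rw [mul_comm]
  exact mul_le_mul_of_nonneg_left hfl (Real.log_nonneg hC1)

theorem IsC0Semigroup.continuous_uncurry_max [CompleteSpace H] (hU : IsC0Semigroup U) :
    Continuous fun p : ℝ × H => U (max p.1 0) p.2 := by
  obtain ⟨M, ω, -, -, hb⟩ := hU.exists_exp_bound
  refine continuous_iff_continuousAt.2 fun ⟨t₀, x₀⟩ => ?_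
  refine tendsto_iff_norm_sub_tendsto_zero.2 ?_
  have hcont : Continuous fun p : ℝ × H => M * Real.exp (ω * max p.1 0) * ‖p.2 - x₀‖ +
      ‖U (max p.1 0) x₀ - U (max t₀ 0) x₀‖ := by
    have := (hU.continuous_orbit_max x₀).comp (continuous_fst : Continuous (Prod.fst : ℝ × H → ℝ))
    exact Continuous.add (by fun_prop) (this.sub continuous_const).norm
  refine squeeze_zero (fun _ => norm_nonneg _) (fun p => ?_)
    (g := fun p : ℝ × H => M * Real.exp (ω * max p.1 0) * ‖p.2 - x₀‖ +
      ‖U (max p.1 0) x₀ - U (max t₀ 0) x₀‖) (by simpa using hcont.tendsto (t₀, x₀))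
  have h : U (max p.1 0) p.2 - U (max t₀ 0) x₀
      = U (max p.1 0) (p.2 - x₀) + (U (max p.1 0) x₀ - U (max t₀ 0) x₀) := by
    rw [map_sub]; abel
  rw [h]
  refine (norm_add_le _ _).trans (add_le_add_left ?_ _)
  exact ((U (max p.1 0)).le_opNorm _).trans
    (mul_le_mul_of_nonneg_right (hb _ (le_max_right _ _)) (norm_nonneg _))

theorem IsC0Semigroup.continuous_max_apply [CompleteSpace H] (hU : IsC0Semigroup U) {X : Type*}
    [TopologicalSpace X] {f : X → ℝ} {g : X → H} (hf : Continuous f) (hg : Continuous g) :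
    Continuous fun p => U (max (f p) 0) (g p) :=
  hU.continuous_uncurry_max.comp (hf.prodMk hg)

/-! ### The generator: density of the domain, differentiability of orbits, closedness. -/

/-- Averages over `[0, h]` of a jointly continuous function converge as `h ↘ 0`. -/
theorem tendsto_average {E : Type*} [NormedAddCommGroup E] [NormedSpace ℝ E]
    {F : ℝ → ℝ → E} (hF : Continuous (Function.uncurry F)) {f : ℝ → E}
    (hf : ∀ h, 0 ≤ h → f h = ∫ s in (0 : ℝ)..h, F h s) [CompleteSpace E] :
    Tendsto (fun h : ℝ => h⁻¹ • f h) (𝓝[>] 0) (𝓝 (F 0 0)) := by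
  -- The substitution `s = h * u` turns the average into a parametric integral over a fixed
  -- interval, which is continuous even at `h = 0`.
  have hcont : Continuous fun h : ℝ => ∫ u in (0 : ℝ)..1, F h (h * u) :=
    intervalIntegral.continuous_parametric_intervalIntegral_of_continuous'
      (f := fun h u => F h (h * u))
      (hF.comp (f := fun p : ℝ × ℝ => (p.1, p.1 * p.2)) (by fun_prop)) 0 1
  have h0 := hcont.tendsto 0
  simp only [zero_mul, intervalIntegral.integral_const, sub_zero, one_smul] at h0
  refine (h0.mono_left nhdsWithin_le_nhds).congr' ?_
  filter_upwards [self_mem_nhdsWithin] with h (hh : 0 < h)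
  rw [intervalIntegral.integral_comp_mul_left _ hh.ne', mul_zero, mul_one, hf h hh.le]

/-- The difference quotient telescopes to the average of the orbit over `[t, t + h]` minus that over
`[0, h]`. -/
theorem IsC0Semigroup.hasGeneratorValue_integral [CompleteSpace H] (hU : IsC0Semigroup U) (x : H)
    {t : ℝ} (ht : 0 ≤ t) :
    HasGeneratorValue U (∫ s in (0 : ℝ)..t, U (max s 0) x) (U t x - x) := by
  have hc := hU.continuous_orbit_max x
  have hi : ∀ a b, IntervalIntegrable (fun s => U (max s 0) x) volume a b :=
    fun a b => hc.intervalIntegrable a b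
  have h := tendsto_average (F := fun _ s => U (max (t + s) 0) x - U (max s 0) x)
    (f := fun h => U h (∫ s in (0 : ℝ)..t, U (max s 0) x) - ∫ s in (0 : ℝ)..t, U (max s 0) x)
    (by
      refine Continuous.sub ?_ ?_
      · exact hc.comp (f := fun p : ℝ × ℝ => t + p.2) (by fun_prop)
      · exact hc.comp (f := fun p : ℝ × ℝ => p.2) (by fun_prop)) ?_
  · simpa [hU.map_zero_apply, ht, HasGeneratorValue] using h
  · intro h hh
    rw [← (U h).intervalIntegral_comp_comm (hi _ _)]
    have e1 : ∫ s in (0 : ℝ)..t, U h (U (max s 0) x) = ∫ s in h..h + t, U (max s 0) x := by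
      have := intervalIntegral.integral_comp_add_left (a := 0) (b := t)
        (fun s => U (max s 0) x) h
      rw [add_zero] at this
      rw [← this]
      refine intervalIntegral.integral_congr fun s hs => ?_
      rw [uIcc_of_le ht] at hs
      rw [max_eq_left hs.1, max_eq_left (add_nonneg hh hs.1), hU.map_add_apply hh hs.1]
    have hi' : IntervalIntegrable (fun s => U (max (t + s) 0) x) volume 0 h :=
      (hc.comp (f := fun s : ℝ => t + s) (by fun_prop)).intervalIntegrable _ _
    rw [intervalIntegral.integral_sub hi' (hi _ _),
      intervalIntegral.integral_comp_add_left (fun s => U (max s 0) x) t, e1, add_zero,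
      ← intervalIntegral.integral_add_adjacent_intervals (hi h t) (hi t (h + t)), add_comm h t,
      ← intervalIntegral.integral_add_adjacent_intervals (hi 0 h) (hi h t)]
    abel

theorem IsC0Semigroup.dense_generator_domain [CompleteSpace H] (hU : IsC0Semigroup U) :
    Dense ((generator U).domain : Set H) := by
  intro x
  have h := tendsto_average (F := fun _ s => U (max s 0) x)
    (f := fun h => ∫ s in (0 : ℝ)..h, U (max s 0) x)
    ((hU.continuous_orbit_max x).comp (f := fun p : ℝ × ℝ => p.2) (by fun_prop)) fun _ _ => rfl
  simp only [max_self, hU.map_zero_apply] at h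
  refine mem_closure_of_tendsto h ?_
  filter_upwards [self_mem_nhdsWithin] with h (hh : 0 < h)
  have hm : (∫ s in (0 : ℝ)..h, U (max s 0) x) ∈ (generator U).domain :=
    ⟨_, hU.hasGeneratorValue_integral x hh.le⟩
  have := (generator U).domain.smul_mem ((h⁻¹ : ℝ) : ℂ) hm
  rwa [Complex.coe_smul] at this

theorem HasGeneratorValue.apply (hU : IsC0Semigroup U) {x y : H} (h : HasGeneratorValue U x y)
    {t : ℝ} (ht : 0 ≤ t) : HasGeneratorValue U (U t x) (U t y) := by
  refine (((U t).continuous.tendsto y).comp h).congr' ?_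
  filter_upwards [self_mem_nhdsWithin] with s (hs : 0 < s)
  simp only [Function.comp]
  rw [← hU.map_add_apply hs.le ht, add_comm s t, hU.map_add_apply ht hs.le, ← map_sub,
    (U t).map_smul_of_tower]

theorem tendsto_sub_nhdsGT (t : ℝ) : Tendsto (fun s : ℝ => s - t) (𝓝[>] t) (𝓝[>] 0) := by
  refine tendsto_nhdsWithin_iff.2 ⟨?_, ?_⟩
  · have : Tendsto (fun s : ℝ => s - t) (𝓝 t) (𝓝 (t - t)) :=
      (continuous_id.sub continuous_const).tendsto t
    rw [sub_self] at this
    exact this.mono_left nhdsWithin_le_nhds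
  · filter_upwards [self_mem_nhdsWithin] with s (hs : t < s)
    exact sub_pos.2 hs

theorem HasGeneratorValue.hasDerivWithinAt_Ici (hU : IsC0Semigroup U) {x y : H}
    (h : HasGeneratorValue U x y) {t : ℝ} (ht : 0 ≤ t) :
    HasDerivWithinAt (fun s => U s x) (U t y) (Ici t) t := by
  rw [← hasDerivWithinAt_Ioi_iff_Ici, hasDerivWithinAt_iff_tendsto_slope' self_notMem_Ioi]
  refine ((h.apply hU ht).comp (tendsto_sub_nhdsGT t)).congr' ?_
  filter_upwards [self_mem_nhdsWithin] with s (hs : t < s)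
  simp only [Function.comp]
  rw [slope_def_module, ← hU.map_add_apply (sub_pos.2 hs).le ht, sub_add_cancel]

theorem HasGeneratorValue.integral_eq (hU : IsC0Semigroup U) {x y : H} [CompleteSpace H]
    (h : HasGeneratorValue U x y) {t : ℝ} (ht : 0 ≤ t) :
    ∫ s in (0 : ℝ)..t, U (max s 0) y = U t x - x := by
  rw [intervalIntegral.integral_eq_sub_of_hasDeriv_right (f := fun s => U s x),
    hU.map_zero_apply]
  · rw [uIcc_of_le ht]
    exact (hU.continuousOn_orbit x).mono Icc_subset_Ici_self
  · intro s hs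
    rw [min_eq_left ht] at hs
    rw [max_eq_left hs.1.le, hasDerivWithinAt_Ioi_iff_Ici]
    exact h.hasDerivWithinAt_Ici hU hs.1.le
  · exact (hU.continuous_orbit_max y).intervalIntegrable _ _

/-- The orbit is the integral of a continuous function, which upgrades the right derivative to a
two-sided one for `t > 0`. -/
theorem HasGeneratorValue.hasDerivWithinAt (hU : IsC0Semigroup U) {x y : H} [CompleteSpace H]
    (h : HasGeneratorValue U x y) {t : ℝ} (ht : 0 ≤ t) :
    HasDerivWithinAt (fun s => U s x) (U t y) (Ici 0) t := by
  have hd := ((hU.continuous_orbit_max y).integral_hasStrictDerivAt 0 t).hasDerivAt.hasDerivWithinAt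
    (s := Ici 0)
  rw [max_eq_left ht] at hd
  refine (hd.add_const x).congr (fun s hs => ?_) ?_
  · rw [h.integral_eq hU hs, sub_add_cancel]
  · rw [h.integral_eq hU ht, sub_add_cancel]

theorem mem_graph_generator {x y : H} : (x, y) ∈ (generator U).graph ↔ HasGeneratorValue U x y := by
  rw [LinearPMap.mem_graph_iff]
  constructor
  · rintro ⟨x', rfl, rfl⟩
    exact generator_spec U x'
  · intro h
    exact ⟨⟨x, y, h⟩, rfl, (generator_spec U ⟨x, y, h⟩).unique h⟩

theorem hasGeneratorValue_iff_integral [CompleteSpace H] (hU : IsC0Semigroup U) {x y : H} :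
    HasGeneratorValue U x y ↔
      ∀ t, 0 ≤ t → ∫ s in (0 : ℝ)..t, U (max s 0) y = U t x - x := by
  refine ⟨fun h t ht => h.integral_eq hU ht, fun h => ?_⟩
  have h := tendsto_average (F := fun _ s => U (max s 0) y)
    (f := fun h => U h x - x)
    ((hU.continuous_orbit_max y).comp (f := fun p : ℝ × ℝ => p.2) (by fun_prop))
    fun t ht => (h t ht).symm
  simpa [hU.map_zero_apply, HasGeneratorValue] using h

/-- The integral form of the generator relation exhibits the graph as an intersection of closed
sets. -/
theorem IsC0Semigroup.isClosed_generator [CompleteSpace H] (hU : IsC0Semigroup U) :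
    (generator U).IsClosed := by
  have : ((generator U).graph : Set (H × H)) =
      ⋂ t : Ici (0 : ℝ), {p : H × H | ∫ s in (0 : ℝ)..t, U (max s 0) p.2 = U t p.1 - p.1} := by
    ext ⟨x, y⟩
    simp only [SetLike.mem_coe, mem_graph_generator, hasGeneratorValue_iff_integral hU]
    simp
  rw [LinearPMap.IsClosed, this]
  refine isClosed_iInter fun t => isClosed_eq ?_ (by fun_prop)
  exact intervalIntegral.continuous_parametric_intervalIntegral_of_continuous'
    (f := fun (p : H × H) s => U (max s 0) p.2)
    (hU.continuous_max_apply (f := fun q : (H × H) × ℝ => q.2) (by fun_prop) (by fun_prop)) 0 t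

/-! ### Uniqueness of the semigroup with a given generator. -/

/-- A continuous solution of the abstract Cauchy problem coincides with the orbit. -/
theorem IsC0Semigroup.eq_orbit_of_hasGeneratorValue [CompleteSpace H] (hU : IsC0Semigroup U)
    {y y' : ℝ → H} (hc : ContinuousOn y (Ici 0))
    (hy : ∀ t, 0 ≤ t → HasDerivWithinAt y (y' t) (Ici t) t)
    (hgen : ∀ t, 0 ≤ t → HasGeneratorValue U (y t) (y' t)) {t : ℝ} (ht : 0 ≤ t) :
    y t = U t (y 0) := by
  -- `s ↦ U(t-s) y(s)` joins `U(t) y(0)` to `y(t)` and has zero right derivative: its slope is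
  -- `U(t-r)` applied to the slope of `y` minus the difference quotient of `U` at `y(s)`, and both
  -- of these tend to `y'(s)`.
  have hconst := constant_of_has_deriv_right_zero
    (f := fun s => U (max (t - s) 0) (y s)) (a := 0) (b := t) ?_ ?_ t ⟨ht, le_rfl⟩
  · simpa [hU.map_zero_apply, ht] using hconst
  · have := hU.continuous_uncurry_max.comp_continuousOn
      (f := fun s => (t - s, y s)) (s := Icc 0 t)
      (ContinuousOn.prodMk (by fun_prop) (hc.mono Icc_subset_Ici_self))
    exact this
  · rintro s ⟨hs0, hst⟩
    rw [← hasDerivWithinAt_Ioi_iff_Ici, hasDerivWithinAt_iff_tendsto_slope' self_notMem_Ioi]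
    have hsl := hy s hs0
    rw [← hasDerivWithinAt_Ioi_iff_Ici,
      hasDerivWithinAt_iff_tendsto_slope' self_notMem_Ioi] at hsl
    have hdiff := hsl.sub ((hgen s hs0).comp (tendsto_sub_nhdsGT s))
    rw [sub_self] at hdiff
    have htime : Tendsto (fun r : ℝ => t - r) (𝓝[>] s) (𝓝 (t - s)) :=
      ((continuous_const.sub continuous_id).tendsto s).mono_left nhdsWithin_le_nhds
    have := (hU.continuous_uncurry_max.tendsto (t - s, 0)).comp (htime.prodMk_nhds hdiff)
    rw [_root_.map_zero (U (max (t - s, (0 : H)).1 0))] at this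
    refine this.congr' ?_
    filter_upwards [Ioo_mem_nhdsGT hst] with r ⟨hr1, hr2⟩
    simp only [Function.comp]
    have e : U (max (t - s) 0) (y s) = U (max (t - r) 0) (U (r - s) (y s)) := by
      rw [max_eq_left (by linarith), max_eq_left (by linarith),
        ← hU.map_add_apply (by linarith) (by linarith)]
      congr 2; ring
    rw [slope_def_module, slope_def_module, e, ← smul_sub, ContinuousLinearMap.map_smul_of_tower,
      ← map_sub]
    congr 2
    abel

/-- A strongly continuous semigroup is determined by its generator. -/
theorem IsC0Semigroup.eq_of_generator_eq [CompleteSpace H] (hU : IsC0Semigroup U)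
    {V : ℝ → H →L[ℂ] H} (hV : IsC0Semigroup V) (h : generator V = generator U) {t : ℝ}
    (ht : 0 ≤ t) : V t = U t := by
  refine ContinuousLinearMap.coeFn_injective <|
    (V t).continuous.ext_on hV.dense_generator_domain (U t).continuous ?_
  rintro x ⟨y, hxy⟩
  have := hU.eq_orbit_of_hasGeneratorValue (y := fun s => V s x) (y' := fun s => V s y)
    (hV.continuousOn_orbit x) (fun s hs => hxy.hasDerivWithinAt_Ici hV hs)
    (fun s hs => by
      rw [← mem_graph_generator, ← h, mem_graph_generator]
      exact hxy.apply hV hs) ht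
  rwa [hV.map_zero_apply] at this

/-! ### Bounded perturbation and Duhamel's formula. -/

theorem IsC0Semigroup.exp_smul (hU : IsC0Semigroup U) (c : ℝ) :
    IsC0Semigroup fun t => Real.exp (c * t) • U t where
  map_zero := by simp [hU.map_zero]
  map_add s t hs ht := by
    rw [hU.map_add s t hs ht, mul_add, Real.exp_add, smul_mul_smul_comm]
  continuousOn_orbit x := by
    have := hU.continuousOn_orbit x
    have hexp : ContinuousOn (fun t : ℝ => Real.exp (c * t)) (Ici 0) := by fun_prop
    exact hexp.smul this

theorem integral_exp_decay_le {μ : ℝ} (hμ : 0 < μ) (t : ℝ) :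
    ∫ s in (0 : ℝ)..t, Real.exp (-μ * (t - s)) ≤ 1 / μ := by
  have h := intervalIntegral.integral_comp_sub_left (a := 0) (b := t)
    (fun r => Real.exp (-μ * r)) t
  rw [h, sub_self, sub_zero, 
    intervalIntegral.integral_comp_mul_left (fun r => Real.exp r) (neg_ne_zero.2 hμ.ne'),
    integral_exp, mul_zero, Real.exp_zero, smul_eq_mul, inv_neg, neg_mul, ← mul_neg, neg_sub,
    one_div]
  exact mul_le_of_le_one_right (by positivity) (by linarith [Real.exp_pos (-μ * t)])

/-- The Volterra operator `f ↦ (t ↦ ∫ s in 0..t, S (t - s) (A (f s)))` on bounded continuous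
functions, for an exponentially decaying semigroup `S`. -/
theorem IsC0Semigroup.exists_volterra [CompleteSpace H] {S : ℝ → H →L[ℂ] H}
    (hS : IsC0Semigroup S) {M μ : ℝ} (hM : 0 < M) (hμ : 0 < μ)
    (hb : ∀ t, 0 ≤ t → ‖S t‖ ≤ M * Real.exp (-μ * t)) (A : H →L[ℂ] H) :
    ∃ V : (ℝ →ᵇ H) →L[ℂ] (ℝ →ᵇ H), ‖V‖ ≤ M * ‖A‖ / μ ∧
      ∀ f t, V f t = ∫ s in (0 : ℝ)..max t 0, S (max (max t 0 - s) 0) (A (f s)) := by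
  have hcont (f : ℝ →ᵇ H) : Continuous (Function.uncurry fun t s : ℝ =>
      S (max (max t 0 - s) 0) (A (f s))) :=
    hS.continuous_max_apply (f := fun p : ℝ × ℝ => max p.1 0 - p.2)
      (g := fun p => A (f p.2)) (by fun_prop) (by fun_prop)
  have hint (f : ℝ →ᵇ H) (t a b : ℝ) : IntervalIntegrable
      (fun s => S (max (max t 0 - s) 0) (A (f s))) volume a b :=
    ((hcont f).comp (f := fun s : ℝ => (t, s)) (by fun_prop)).intervalIntegrable a b
  have hVcont (f : ℝ →ᵇ H) : Continuous fun t : ℝ =>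
      ∫ s in (0 : ℝ)..max t 0, S (max (max t 0 - s) 0) (A (f s)) :=
    intervalIntegral.continuous_parametric_intervalIntegral_of_continuous (hcont f) (by fun_prop)
  have hbound (f : ℝ →ᵇ H) (t : ℝ) :
      ‖∫ s in (0 : ℝ)..max t 0, S (max (max t 0 - s) 0) (A (f s))‖ ≤ M * ‖A‖ / μ * ‖f‖ := by
    have h1 : ‖∫ s in (0 : ℝ)..max t 0, S (max (max t 0 - s) 0) (A (f s))‖ ≤
        ∫ s in (0 : ℝ)..max t 0, M * ‖A‖ * ‖f‖ * Real.exp (-μ * (max t 0 - s)) := by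
      refine intervalIntegral.norm_integral_le_of_norm_le (le_max_right _ _) ?_
        (Continuous.intervalIntegrable (by fun_prop) _ _)
      refine Eventually.of_forall fun s hs => ?_
      have h0 : 0 ≤ max t 0 - s := sub_nonneg.2 hs.2
      rw [max_eq_left h0]
      calc ‖S (max t 0 - s) (A (f s))‖
          ≤ ‖S (max t 0 - s)‖ * (‖A‖ * ‖f s‖) :=
            ((S _).le_opNorm _).trans (by gcongr; exact A.le_opNorm _)
        _ ≤ (M * Real.exp (-μ * (max t 0 - s))) * (‖A‖ * ‖f‖) := by
            gcongr
            · exact hb _ h0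
            · exact f.norm_coe_le_norm s
        _ = _ := by ring
    refine h1.trans ?_
    rw [intervalIntegral.integral_const_mul]
    refine (mul_le_mul_of_nonneg_left (integral_exp_decay_le hμ _) (by positivity)).trans_eq ?_
    ring
  let V₀ : (ℝ →ᵇ H) →ₗ[ℂ] (ℝ →ᵇ H) :=
    { toFun := fun f => BoundedContinuousFunction.ofNormedAddCommGroup _ (hVcont f) _ (hbound f)
      map_add' := fun f g => by
        ext t
        have := intervalIntegral.integral_add (hint f t 0 (max t 0)) (hint g t 0 (max t 0))
        simpa using this
      map_smul' := fun c f => by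
        ext t
        simp }
  refine ⟨V₀.mkContinuous (M * ‖A‖ / μ) fun f => ?_,
    LinearMap.mkContinuous_norm_le _ (by positivity) _, fun f t => rfl⟩
  exact (BoundedContinuousFunction.norm_le (by positivity)).2 (hbound f)

/-- The orbit map into bounded continuous functions. -/
theorem IsC0Semigroup.exists_orbitMap {S : ℝ → H →L[ℂ] H}
    (hS : IsC0Semigroup S) {M : ℝ} (hM : 0 ≤ M) (hb : ∀ t, 0 ≤ t → ‖S t‖ ≤ M) :
    ∃ J : H →L[ℂ] (ℝ →ᵇ H), ∀ x t, J x t = S (max t 0) x := by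
  have hbound (x : H) (t : ℝ) : ‖S (max t 0) x‖ ≤ M * ‖x‖ :=
    ((S _).le_opNorm _).trans
      (mul_le_mul_of_nonneg_right (hb _ (le_max_right _ _)) (norm_nonneg _))
  let J₀ : H →ₗ[ℂ] (ℝ →ᵇ H) :=
    { toFun := fun x => BoundedContinuousFunction.ofNormedAddCommGroup _
        (hS.continuous_orbit_max x) _ (hbound x)
      map_add' := fun x y => by ext t; simp
      map_smul' := fun c x => by ext t; simp }
  refine ⟨J₀.mkContinuous M fun x => ?_, fun x t => rfl⟩
  exact (BoundedContinuousFunction.norm_le (by positivity)).2 (hbound x)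

/-- The smallness condition makes the Volterra operator `V` a strict contraction, so `1 - V` is
invertible and `f = J x + V f` has a unique bounded continuous solution. Uniqueness also yields the
semigroup law. -/
theorem IsC0Semigroup.exists_perturbation_of_decay [CompleteSpace H] {S : ℝ → H →L[ℂ] H}
    (hS : IsC0Semigroup S) {M μ : ℝ} (hM : 0 < M) (hμ : 0 < μ)
    (hb : ∀ t, 0 ≤ t → ‖S t‖ ≤ M * Real.exp (-μ * t)) {A : H →L[ℂ] H} (hA : M * ‖A‖ < μ) :
    ∃ G : ℝ → H →L[ℂ] H, IsC0Semigroup G ∧ ∀ x t, 0 ≤ t →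
      G t x = S t x + ∫ s in (0 : ℝ)..t, S (t - s) (A (G s x)) := by
  obtain ⟨V, hVn, hV⟩ := hS.exists_volterra hM hμ hb A
  obtain ⟨J, hJ⟩ := hS.exists_orbitMap hM.le fun t ht => (hb t ht).trans <| by
    refine mul_le_of_le_one_right hM.le (Real.exp_le_one_iff.2 ?_)
    nlinarith
  obtain ⟨u, hu⟩ := isUnit_one_sub_of_norm_lt_one
    (R := (ℝ →ᵇ H) →L[ℂ] (ℝ →ᵇ H)) (hVn.trans_lt ((div_lt_one hμ).2 hA))
  let W : (ℝ →ᵇ H) →L[ℂ] (ℝ →ᵇ H) := ↑u⁻¹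
  have hW1 (g : ℝ →ᵇ H) : W g = g + V (W g) := by
    have : (1 - V) * W = 1 := by rw [← hu]; exact u.mul_inv
    have := congrArg (fun T : (ℝ →ᵇ H) →L[ℂ] (ℝ →ᵇ H) => T g) this
    exact sub_eq_iff_eq_add.1 this
  have hW2 (f g : ℝ →ᵇ H) (h : f = g + V f) : f = W g := by
    have h1 : W * (1 - V) = 1 := by rw [← hu]; exact u.inv_mul
    have h2 := congrArg (fun T : (ℝ →ᵇ H) →L[ℂ] (ℝ →ᵇ H) => T f) h1
    have h3 : (1 - V) f = g := sub_eq_iff_eq_add.2 h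
    change W ((1 - V) f) = f at h2
    rw [← h2, h3]
  have hmild (x : H) {t : ℝ} (ht : 0 ≤ t) : W (J x) t = S t x +
      ∫ s in (0 : ℝ)..t, S (max (t - s) 0) (A (W (J x) s)) := by
    conv_lhs => rw [hW1]
    rw [BoundedContinuousFunction.add_apply, hJ, hV, max_eq_left ht]
  have hint (x : H) (t a b : ℝ) : IntervalIntegrable
      (fun s => S (max (t - s) 0) (A (W (J x) s))) volume a b :=
    (hS.continuous_max_apply (f := fun s : ℝ => t - s) (g := fun s => A (W (J x) s))
      (by fun_prop) (by fun_prop)).intervalIntegrable a b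
  refine ⟨fun t => (BoundedContinuousFunction.evalCLM ℂ t).comp (W.comp J), ⟨?_, ?_, ?_⟩, ?_⟩
  · ext x
    change W (J x) 0 = x
    rw [hmild x le_rfl, intervalIntegral.integral_same, add_zero, hS.map_zero_apply]
  · intro t s ht hs
    ext x
    change W (J x) (t + s) = W (J (W (J x) s)) t
    set f := W (J x) with hf
    -- The solution shifted by `s` solves the equation with initial value `f s`, as splitting its
    -- integral at `s` shows. It is clamped because the equation is posed on all of `ℝ` and its
    -- right side depends only on `max r 0`.
    let f' : ℝ →ᵇ H := f.compContinuous ⟨fun r => max r 0 + s, by fun_prop⟩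
    have hf' : f' = W (J (f s)) := by
      refine hW2 _ _ ?_
      ext r
      rw [BoundedContinuousFunction.add_apply, hJ, hV]
      change f (max r 0 + s) = _
      obtain ⟨τ, hτ⟩ : ∃ τ, τ = max r 0 := ⟨_, rfl⟩
      have hτ0 : 0 ≤ τ := hτ ▸ le_max_right _ _
      rw [← hτ, hmild x (add_nonneg hτ0 hs), ← hf]
      nth_rewrite 2 [hf]
      rw [hmild x hs, ← hf, _root_.map_add, ← hS.map_add_apply hτ0 hs,
        ← (S τ).intervalIntegral_comp_comm (hint x s 0 s), add_assoc,
        ← intervalIntegral.integral_add_adjacent_intervals (hint x (τ + s) 0 s)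
          (hint x (τ + s) s (τ + s))]
      congr 2
      · refine intervalIntegral.integral_congr fun q hq => ?_
        rw [uIcc_of_le hs] at hq
        change S (max (τ + s - q) 0) (A (f q)) = S τ (S (max (s - q) 0) (A (f q)))
        rw [max_eq_left (sub_nonneg.2 hq.2), ← hS.map_add_apply hτ0 (sub_nonneg.2 hq.2),
          max_eq_left (by linarith [hq.2]), add_sub_assoc]
      · have := intervalIntegral.integral_comp_add_right (a := 0) (b := τ)
          (fun q => S (max (τ + s - q) 0) (A (f q))) s
        rw [zero_add] at this
        rw [← this]
        refine intervalIntegral.integral_congr fun q hq => ?_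
        rw [uIcc_of_le hτ0] at hq
        change S (max (τ + s - (q + s)) 0) (A (f (q + s))) =
          S (max (τ - q) 0) (A (f (max q 0 + s)))
        rw [max_eq_left hq.1, add_sub_add_right_eq_sub]
    rw [← hf']
    change _ = f (max t 0 + s)
    rw [max_eq_left ht]
  · intro x
    exact (W (J x)).continuous.continuousOn
  · intro x t ht
    refine (hmild x ht).trans ?_
    congr 1
    refine intervalIntegral.integral_congr fun s hs => ?_
    rw [uIcc_of_le ht] at hs
    change S (max (t - s) 0) (A (W (J x) s)) = S (t - s) (A (W (J x) s))
    rw [max_eq_left (sub_nonneg.2 hs.2)]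

/-- Bounded perturbation of a strongly continuous semigroup, with Duhamel's formula. -/
theorem IsC0Semigroup.exists_perturbation [CompleteSpace H] (hU : IsC0Semigroup U)
    (A : H →L[ℂ] H) :
    ∃ G : ℝ → H →L[ℂ] H, IsC0Semigroup G ∧ ∀ x t, 0 ≤ t →
      G t x = U t x + ∫ s in (0 : ℝ)..t, U (t - s) (A (G s x)) := by
  obtain ⟨M, ω, hM, hω, hb⟩ := hU.exists_exp_bound
  -- Damping by `exp (-c * t)` leaves decay rate `M * ‖A‖ + 1`, just enough for the smallness
  -- condition; Duhamel's formula is compatible with undoing it.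
  set c := ω + (M * ‖A‖ + 1)
  obtain ⟨G, hG, hGd⟩ := (hU.exp_smul (-c)).exists_perturbation_of_decay (M := M)
    (μ := M * ‖A‖ + 1) hM (by positivity) (fun t ht => by
      rw [norm_smul, Real.norm_eq_abs, Real.abs_exp]
      refine (mul_le_mul_of_nonneg_left (hb t ht) (Real.exp_pos _).le).trans_eq ?_
      rw [mul_left_comm, ← Real.exp_add]
      congr 2
      simp only [c]; ring) (A := A) (by linarith)
  refine ⟨_, hG.exp_smul c, fun x t ht => ?_⟩
  have hexp : ∀ r : ℝ, Real.exp (c * r) * Real.exp (-c * r) = 1 := fun r => by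
    rw [← Real.exp_add]; simp
  rw [_root_.smul_apply, hGd x t ht, smul_add, _root_.smul_apply,
    smul_smul, hexp, one_smul, ← intervalIntegral.integral_smul]
  congr 1
  refine intervalIntegral.integral_congr fun s _ => ?_
  simp only [_root_.smul_apply, ContinuousLinearMap.map_smul_of_tower]
  rw [smul_smul, ← Real.exp_add]
  congr 2
  ring

/-- By Duhamel, `(G t x - U t x) / t` is an average of a function with value `A x` at the origin. -/
theorem hasGeneratorValue_perturbation_iff [CompleteSpace H] (hU : IsC0Semigroup U)
    {A : H →L[ℂ] H} {G : ℝ → H →L[ℂ] H} (hG : IsC0Semigroup G)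
    (hd : ∀ x t, 0 ≤ t → G t x = U t x + ∫ s in (0 : ℝ)..t, U (t - s) (A (G s x))) {x y : H} :
    HasGeneratorValue G x y ↔ HasGeneratorValue U x (y - A x) := by
  have h := tendsto_average (F := fun t s => U (max (t - s) 0) (A (G (max s 0) x)))
    (f := fun t => G t x - U t x)
    (hU.continuous_max_apply (f := fun p : ℝ × ℝ => p.1 - p.2)
      (g := fun p => A (G (max p.2 0) x)) (by fun_prop)
      (A.continuous.comp ((hG.continuous_orbit_max x).comp continuous_snd))) (fun t ht => by
        rw [hd x t ht, add_sub_cancel_left]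
        refine intervalIntegral.integral_congr fun s hs => ?_
        rw [uIcc_of_le ht] at hs
        rw [max_eq_left (sub_nonneg.2 hs.2), max_eq_left hs.1])
  simp only [sub_self, max_self, hU.map_zero_apply, hG.map_zero_apply] at h
  constructor
  · intro hx
    refine (Tendsto.sub hx h).congr fun t => ?_
    rw [← smul_sub]
    congr 1
    abel
  · intro hx
    have := Tendsto.add hx h
    rw [sub_add_cancel] at this
    refine this.congr fun t => ?_
    rw [← smul_add]
    congr 1
    abel

theorem _root_.LinearPMap.IsClosed.closure_eq {T : H →ₗ.[ℂ] H} (hT : T.IsClosed) :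
    T.closure = T := by
  refine LinearPMap.eq_of_eq_graph ?_
  rw [← hT.isClosable.graph_closure_eq_closure_graph]
  exact _root_.IsClosed.submodule_topologicalClosure_eq hT

/-! ### The Mori projection and the orthogonal generator. -/

theorem moriQ_apply (z x : H) : moriQ z x = x - moriP z x := rfl

theorem inner_moriQ {z : H} (hz0 : z ≠ 0) (x : H) : inner ℂ z (moriQ z x) = 0 := by
  rw [moriQ_apply, moriP_apply, inner_sub_right, inner_smul_right,
    div_mul_cancel₀ _ (inner_self_ne_zero.2 hz0), sub_self]

/-- The everywhere defined bounded extension of `P L`, where `w = L† z`. -/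
noncomputable def moriPExtension (z w : H) : H →L[ℂ] H :=
  (inner ℂ z z)⁻¹ • (innerSL ℂ w).smulRight z

theorem moriPExtension_apply (z w x : H) :
    moriPExtension z w x = (inner ℂ w x / inner ℂ z z) • z := by
  simp [moriPExtension, smul_smul, div_eq_inv_mul]

/-- The bounded operator by which `L` has to be perturbed to obtain `Q L Q`, where `w = L† z` and
`v = Q L z`. -/
noncomputable def moriPerturbation (z w v : H) : H →L[ℂ] H :=
  -(moriPExtension z w + (inner ℂ z z)⁻¹ • (innerSL ℂ z).smulRight v)

theorem moriPerturbation_apply (z w v x : H) :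
    moriPerturbation z w v x =
      -(moriPExtension z w x + (inner ℂ z x / inner ℂ z z) • v) := by
  simp [moriPerturbation, smul_smul, div_eq_inv_mul]

theorem moriQ_mem_domain {L : H →ₗ.[ℂ] H} {z : H} (hz : z ∈ L.domain) {x : H} : moriQ z x ∈ L.domain ↔ x ∈ L.domain := by
  rw [moriQ_apply, moriP_apply]
  exact Submodule.sub_mem_iff_left _ (L.domain.smul_mem _ hz)

/-- On the orthogonal complement of `z` the `v` term vanishes, and `w` may be replaced by `Q w`.
This is where the memory kernel comes from. -/
theorem neg_moriPerturbation_apply_of_inner_eq_zero {z w v x : H} (hx : inner ℂ z x = 0) :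
    -moriPerturbation z w v x = (inner ℂ (moriQ z w) x / inner ℂ z z) • z := by
  rw [moriPerturbation_apply, neg_neg, hx, zero_div, zero_smul, add_zero, moriPExtension_apply,
    moriQ_apply, moriP_apply, inner_sub_left, inner_smul_left, hx, mul_zero, sub_zero]

variable [CompleteSpace H] {L : H →ₗ.[ℂ] H} {z : H}

theorem moriP_apply_eq_extension (hd : Dense (L.domain : Set H)) (hz' : z ∈ L†.domain)
    (x : L.domain) : moriP z (L x) = moriPExtension z (L† ⟨z, hz'⟩) x := by
  rw [moriP_apply, moriPExtension_apply, LinearPMap.adjoint_isFormalAdjoint hd ⟨z, hz'⟩ x]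

/-- The graph is the preimage of the graph of `L` under a continuous shear built from the bounded
extension of `PL`. -/
theorem isClosed_opQL (hL : L.IsClosed) (hd : Dense (L.domain : Set H)) (hz' : z ∈ L†.domain) :
    (opQL L z).IsClosed := by
  have : ((opQL L z).graph : Set (H × H)) =
      (fun p : H × H => (p.1, p.2 + moriPExtension z (L† ⟨z, hz'⟩) p.1)) ⁻¹'
        (L.graph : Set (H × H)) := by
    ext ⟨x, y⟩
    simp only [mem_preimage, SetLike.mem_coe, LinearPMap.mem_graph_iff]
    refine exists_congr fun (x' : L.domain) => and_congr_right fun hx => ?_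
    rw [← hx, ← moriP_apply_eq_extension hd hz' x', ← sub_eq_iff_eq_add]
    rfl
  rw [LinearPMap.IsClosed, this]
  exact IsClosed.preimage (by fun_prop) hL

theorem orthogonalGenerator_eq (hL : L.IsClosed) (hd : Dense (L.domain : Set H))
    (hz' : z ∈ L†.domain) :
    orthogonalGenerator L z = compBounded (opQL L z) (moriQ z) := by
  rw [orthogonalGenerator, (isClosed_opQL hL hd hz').closure_eq]

theorem moriQ_apply_moriQ (hd : Dense (L.domain : Set H)) (hz : z ∈ L.domain)
    (hz' : z ∈ L†.domain) (x : L.domain) (hx : moriQ z (x : H) ∈ L.domain) :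
    moriQ z (L ⟨moriQ z (x : H), hx⟩) =
      L x + moriPerturbation z (L† ⟨z, hz'⟩) (moriQ z (L ⟨z, hz⟩)) x := by
  have h : (⟨moriQ z (x : H), hx⟩ : L.domain) =
      x - (inner ℂ z (x : H) / inner ℂ z z) • (⟨z, hz⟩ : L.domain) := by
    ext
    simp [moriQ_apply, moriP_apply]
  rw [h, LinearPMap.map_sub, LinearPMap.map_smul, map_sub, map_smul, moriPerturbation_apply,
    moriQ_apply z (L x), moriP_apply_eq_extension hd hz']
  abel

theorem mem_graph_orthogonalGenerator_iff (hL : L.IsClosed) (hd : Dense (L.domain : Set H))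
    (hz : z ∈ L.domain) (hz' : z ∈ L†.domain) {x y : H} :
    (x, y) ∈ (orthogonalGenerator L z).graph ↔
      (x, y - moriPerturbation z (L† ⟨z, hz'⟩) (moriQ z (L ⟨z, hz⟩)) x) ∈ L.graph := by
  rw [orthogonalGenerator_eq hL hd hz', LinearPMap.mem_graph_iff, LinearPMap.mem_graph_iff]
  constructor
  · rintro ⟨⟨x', hx'⟩, rfl, hy⟩
    have hxL : x' ∈ L.domain := (moriQ_mem_domain hz).1 hx'
    refine ⟨⟨x', hxL⟩, rfl, ?_⟩
    refine eq_sub_iff_add_eq.2 (Eq.trans ?_ hy)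
    exact (moriQ_apply_moriQ hd hz hz' ⟨x', hxL⟩ hx').symm
  · rintro ⟨x', rfl, hy⟩
    have hxQ : moriQ z (x' : H) ∈ L.domain := (moriQ_mem_domain hz).2 x'.2
    refine ⟨⟨x', hxQ⟩, rfl, ?_⟩
    rw [eq_sub_iff_add_eq, ← moriQ_apply_moriQ hd hz hz' x' hxQ] at hy
    exact hy

theorem inner_eq_zero_of_mem_graph_orthogonalGenerator (hL : L.IsClosed)
    (hd : Dense (L.domain : Set H)) (hz' : z ∈ L†.domain) (hz0 : z ≠ 0) {x y : H}
    (h : (x, y) ∈ (orthogonalGenerator L z).graph) : inner ℂ z y = 0 := by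
  rw [orthogonalGenerator_eq hL hd hz', LinearPMap.mem_graph_iff] at h
  obtain ⟨x', -, rfl⟩ := h
  exact inner_moriQ hz0 _

/-- If the generator's range is orthogonal to `z`, the component along `z` has zero derivative on
orbits from the domain; density extends this to all `x`. -/
theorem IsC0Semigroup.inner_apply_eq {G : ℝ → H →L[ℂ] H} (hG : IsC0Semigroup G)
    (h : ∀ x y, HasGeneratorValue G x y → inner ℂ z y = 0) (x : H) {t : ℝ} (ht : 0 ≤ t) :
    inner ℂ z (G t x) = inner ℂ z x := by
  have hcont : Continuous fun x => innerSL ℂ z (G t x) := by fun_prop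
  refine congrFun (hcont.ext_on hG.dense_generator_domain (innerSL ℂ z).continuous ?_) x
  rintro x ⟨y, hxy⟩
  have := constant_of_has_deriv_right_zero (f := fun s => innerSL ℂ z (G s x)) (a := 0) (b := t)
    ((innerSL ℂ z).continuous.comp_continuousOn
      ((hG.continuousOn_orbit x).mono Icc_subset_Ici_self))
    (fun s hs => by
      have h1 := ((innerSL ℂ z).restrictScalars ℝ).hasFDerivAt.comp_hasDerivWithinAt s
        (hxy.hasDerivWithinAt_Ici hG hs.1)
      have h2 : inner ℂ z (G s y) = 0 := h _ _ (hxy.apply hG hs.1)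
      simpa [h2, Function.comp_def] using h1) t ⟨ht, le_rfl⟩
  simpa [hG.map_zero_apply] using this

end MoriGLE

/-! ### The generalized Langevin equation. -/

open MoriGLE in
theorem mainTheorem1 {H : Type*} [NormedAddCommGroup H] [InnerProductSpace ℂ H] [CompleteSpace H]
    (U : ℝ → H →L[ℂ] H) (hU : IsC0Semigroup U)
    (z : H) (hz : z ∈ (generator U).domain) (hz' : z ∈ (generator U)†.domain) (hz0 : z ≠ 0) :
    (opQL (generator U) z).IsClosable ∧
    ∃ G : ℝ → H →L[ℂ] H,
      IsC0Semigroup G ∧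
      generator G = orthogonalGenerator (generator U) z ∧
      (∀ G' : ℝ → H →L[ℂ] H, IsC0Semigroup G' →
        generator G' = orthogonalGenerator (generator U) z → ∀ t : ℝ, 0 ≤ t → G' t = G t) ∧
      ∀ t : ℝ, 0 ≤ t →
        U t z ∈ (generator U).domain ∧
        IntervalIntegrable
          (fun s : ℝ => memoryKernel (generator U) G z hz hz' (t - s) • U s z)
          MeasureTheory.volume 0 t ∧
        HasDerivWithinAt (fun τ : ℝ => U τ z)
          (U t (moriP z (generator U ⟨z, hz⟩)) + G t (moriQ z (generator U ⟨z, hz⟩)) +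
            ∫ s in (0 : ℝ)..t, memoryKernel (generator U) G z hz hz' (t - s) • U s z)
          (Ici 0) t := by
  have hL := hU.isClosed_generator
  have hd := hU.dense_generator_domain
  set w := (generator U)† ⟨z, hz'⟩ with hw
  set v := moriQ z (generator U ⟨z, hz⟩) with hv
  obtain ⟨G, hG, hduh⟩ := hU.exists_perturbation (moriPerturbation z w v)
  have hgen : generator G = orthogonalGenerator (generator U) z := by
    refine LinearPMap.eq_of_eq_graph ?_
    ext ⟨x, y⟩
    rw [mem_graph_orthogonalGenerator_iff hL hd hz hz', mem_graph_generator, mem_graph_generator,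
      hasGeneratorValue_perturbation_iff hU hG hduh]
  refine ⟨(isClosed_opQL hL hd hz').isClosable, G, hG, hgen,
    fun G' hG' h' t ht => hG.eq_of_generator_eq hG' (h'.trans hgen.symm) ht, fun t ht => ?_⟩
  have hgv : HasGeneratorValue U z (generator U ⟨z, hz⟩) := generator_spec U ⟨z, hz⟩
  have hort : ∀ s, 0 ≤ s → inner ℂ z (G s v) = 0 := fun s hs => by
    rw [hG.inner_apply_eq (fun x y hxy => ?_) v hs, hv, inner_moriQ hz0]
    exact inner_eq_zero_of_mem_graph_orthogonalGenerator hL hd hz' hz0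
      (hgen ▸ mem_graph_generator.2 hxy)
  have hK : ∀ s, 0 ≤ s →
      memoryKernel (generator U) G z hz hz' s • z = -moriPerturbation z w v (G s v) :=
    fun s hs => (neg_moriPerturbation_apply_of_inner_eq_zero (hort s hs)).symm
  refine ⟨⟨_, hgv.apply hU ht⟩, ?_, ?_⟩
  · refine ContinuousOn.intervalIntegrable ?_
    rw [uIcc_of_le ht]
    refine ContinuousOn.smul ?_ ((hU.continuousOn_orbit z).mono Icc_subset_Ici_self)
    refine ContinuousOn.div_const ?_ _
    refine (innerSL ℂ (moriQ z w)).continuous.comp_continuousOn ?_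
    exact (hG.continuousOn_orbit v).comp (by fun_prop) fun s hs => sub_nonneg.2 hs.2
  -- The derivative is `U(t)Lz`; what remains is to expand `U(t)v` by Duhamel's formula and reflect
  -- `s ↦ t - s` in the memory integral.
  · convert hgv.hasDerivWithinAt hU ht using 1
    have hsplit : generator U ⟨z, hz⟩ = moriP z (generator U ⟨z, hz⟩) + v := by
      rw [hv, moriQ_apply, add_sub_cancel]
    conv_rhs => rw [hsplit, map_add]
    rw [add_assoc]
    congr 1
    rw [hduh v t ht, add_assoc, add_eq_left]
    have hsub := intervalIntegral.integral_comp_sub_left (a := 0) (b := t)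
      (fun s => memoryKernel (generator U) G z hz hz' s • U (t - s) z) t
    simp only [sub_sub_cancel, sub_self, sub_zero] at hsub
    rw [hsub, add_eq_zero_iff_neg_eq, ← intervalIntegral.integral_neg]
    refine intervalIntegral.integral_congr fun s hs => ?_
    rw [uIcc_of_le ht] at hs
    rw [← map_neg, ← hK s hs.1, map_smul]
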